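/- Let $K$ be a number field with ring of integers $\mathcal{O}_K$, let $\mathfrak{a}$ be a nonzero ideal of $\mathcal{O}_K$, and let $s \geq 0$ be an integer. Let $\chi$ be a Dirichlet character modulo $\mathfrak{a}$, that is, a character $(\mathcal{O}_K/\mathfrak{a})^* \to \mathbb{C}^*$ extended by zero to $\mathcal{O}_K/\mathfrak{a}$, and let $\mathfrak{d}$ be its conductor, that is, the greatest common divisor of the ideals $\mathfrak{m} \mid \mathfrak{a}$ such that $\chi$ on $(\mathcal{O}_K/\mathfrak{a})^*$ factors through $(\mathcal{O}_K/\mathfrak{m})^*$. Let $\mathfrak{a}_0 \mid \mathfrak{a}$ be the ideal that has the same prime ideal factors as $\mathfrak{d}$ and satisfies $\gcd(\mathfrak{a}_0, \mathfrak{a}/\mathfrak{a}_0) = 1$. Then $$\sum_{\substack{a_1, a_2, b_1, \ldots, b_s \in \mathcal{O}_K/\mathfrak{a} \\ a_1a_2,\ a_1+a_2 \in (\mathcal{O}_K/\mathfrak{a})^*}} N\big(\gcd(a_1+a_2-1, b_1, \ldots, b_s, \mathfrak{a})\big)\,\chi(a_1) = \mu(\mathfrak{d})\, \phi\!\left(\frac{\mathfrak{a}_0^2}{\mathfrak{d}}\right)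 \phi_2\!\left(\frac{\mathfrak{a}}{\mathfrak{a}_0}\right) \sigma_s\!\left(\frac{\mathfrak{a}}{\mathfrak{d}}\right).$$ Here $\gcd(a_1+a_2-1, b_1, \ldots, b_s, \mathfrak{a})$ is the ideal of $\mathcal{O}_K$ generated by $\mathfrak{a}$ and by representatives of the classes $a_1+a_2-1, b_1, \ldots, b_s$. For a nonzero ideal $\mathfrak{b}$ of $\mathcal{O}_K$, $N(\mathfrak{b}) = |\mathcal{O}_K/\mathfrak{b}|$ is the absolute norm; $\mu(\mathfrak{b}) = (-1)^t$ if $\mathfrak{b}$ is a product of $t \geq 0$ distinct nonzero prime ideals (so $\mu(\mathcal{O}_K) = 1$) and $\mu(\mathfrak{b}) = 0$ otherwise; $\phi(\mathfrak{b}) = |(\mathcal{O}_K/\mathfrak{b})^*|$; $\phi_2(\mathfrak{b})$ is the number of pairs $(a, b)$ of elements of $(\mathcal{O}_K/\mathfrak{b})^*$ with $a + b \in (\mathcal{O}_K/\mathfrak{b})^*$; and $\sigma_s(\mathfrak{b}) = \sum_{\mathfrak{c} \mid \mathfrak{b}} N(\mathfrak{c})^s$. -/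

import Mathlib

open NumberField

namespace MenonSury

variable {R : Type*} [CommRing R]

/-- The greatest common divisor of a family `x : ι → R ⧸ 𝔞` of residue classes and the modulus `𝔞`:
the ideal of `R` generated by `𝔞` and all representatives of the classes `x i`
(see `gcdMod_mk`). -/
def gcdMod (𝔞 : Ideal R) {ι : Type*} (x : ι → R ⧸ 𝔞) : Ideal R :=
  (Ideal.span (Set.range x)).comap (Ideal.Quotient.mk 𝔞)

/-- For representatives `y i` of the classes, `gcdMod` is the sum (which is the gcd) of the principal
ideals generated by the `y i` and of `𝔞`. -/
theorem gcdMod_mk (𝔞 : Ideal R) {ι : Type*} (y : ι → R) :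
    gcdMod 𝔞 (fun i => Ideal.Quotient.mk 𝔞 (y i)) = (⨆ i, Ideal.span {y i}) ⊔ 𝔞 := by
  have h : Ideal.span (Set.range fun i => Ideal.Quotient.mk 𝔞 (y i)) =
      (Ideal.span (Set.range y)).map (Ideal.Quotient.mk 𝔞) := by
    rw [Ideal.map_span, ← Set.range_comp]
    rfl
  rw [gcdMod, h, Ideal.comap_map_of_surjective _ Ideal.Quotient.mk_surjective, Ideal.span_range_eq_iSup,
    ← RingHom.ker_eq_comap_bot, Ideal.mk_ker]

/-- The Euler totient function `φ(𝔟) = |(R/𝔟)ˣ|`. -/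
noncomputable def phi (𝔟 : Ideal R) : ℕ :=
  Nat.card (R ⧸ 𝔟)ˣ

/-- The function `φ₂(𝔟)`: the number of pairs of units of `R/𝔟` whose sum is again a unit. -/
noncomputable def phi₂ (𝔟 : Ideal R) : ℕ :=
  Nat.card {p : (R ⧸ 𝔟)ˣ × (R ⧸ 𝔟)ˣ // IsUnit ((p.1 : R ⧸ 𝔟) + (p.2 : R ⧸ 𝔟))}

/-- The function `σ_s(𝔟) = ∑_{𝔠 ∣ 𝔟} N(𝔠)^s`
(a nonzero ideal of a ring of integers has finitely many divisors). -/
noncomputable def sigma [IsDedekindDomain R] [Module.Free ℤ R] (s : ℕ) (𝔟 : Ideal R) : ℕ :=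
  ∑ᶠ (𝔠 : Ideal R) (_ : 𝔠 ∣ 𝔟), Ideal.absNorm 𝔠 ^ s

/-- A Dirichlet character modulo `𝔞`: a character of `(R/𝔞)ˣ`, extended by zero to `R/𝔞`. -/
abbrev DirichletChar (𝔞 : Ideal R) : Type _ :=
  MulChar (R ⧸ 𝔞) ℂ

/-- `χ` modulo `𝔞` is induced from a character modulo the divisor `𝔪` of `𝔞`: its restriction to
`(R/𝔞)ˣ` factors through the reduction map to `(R/𝔪)ˣ`. -/
def FactorsThrough {𝔞 : Ideal R} (χ : DirichletChar 𝔞) (𝔪 : Ideal R) : Prop :=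
  ∃ (h : 𝔪 ∣ 𝔞) (ψ : DirichletChar 𝔪),
    ∀ u : (R ⧸ 𝔞)ˣ, χ u = ψ (Ideal.Quotient.factor (Ideal.le_of_dvd h) u)

/-- The conductor of `χ`: the greatest common divisor of all moduli `𝔪 ∣ 𝔞` from which `χ` is induced.
The gcd of ideals is their sum, that is, their supremum for inclusion. -/
noncomputable def conductor {𝔞 : Ideal R} (χ : DirichletChar 𝔞) : Ideal R :=
  sSup {𝔪 : Ideal R | FactorsThrough χ 𝔪}

/-- The quotient `𝔞 / 𝔟 = {x | x𝔟 ⊆ 𝔞}` of ideals of a Dedekind domain is the exact quotient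
if `𝔟` divides `𝔞` (it is the only one if moreover `𝔟` is nonzero). -/
theorem div_mul_cancel_of_dvd [IsDedekindDomain R] {𝔞 𝔟 : Ideal R} (h : 𝔟 ∣ 𝔞) :
    𝔞 / 𝔟 * 𝔟 = 𝔞 := by
  obtain ⟨𝔠, rfl⟩ := h
  have h1 : 𝔟 * 𝔠 / 𝔟 * 𝔟 ≤ 𝔟 * 𝔠 := Submodule.le_div_iff_mul_le.mp le_rfl
  have h2 : 𝔠 ≤ 𝔟 * 𝔠 / 𝔟 := Submodule.le_div_iff_mul_le.mpr (mul_comm 𝔠 𝔟).le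
  exact le_antisymm h1 (by rw [mul_comm 𝔟 𝔠] at h2 ⊢; exact Ideal.mul_mono_left h2)

/-- Residue rings of the ring of integers of a number field modulo nonzero ideals are finite. -/
noncomputable instance {K : Type*} [Field K] [NumberField K] (𝔞 : Ideal (𝓞 K)) [NeZero 𝔞] :
    Fintype (𝓞 K ⧸ 𝔞) :=
  haveI := Ideal.finiteQuotientOfFreeOfNeBot 𝔞 (NeZero.ne 𝔞)
  Fintype.ofFinite _

end MenonSury

namespace MenonSury

open UniqueFactorizationMonoid Finset

/-! ### Units and congruences in residue rings. -/

section Quotient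

variable {R : Type*} [CommRing R]

/-! Write `𝔡` for the conductor. Put `u = a₁ + a₂` and `a₁ = u x`, so `a₂ = u (1 - x)`. The
conditions say that `u`, `x` and `1 - x` are units, and the sum splits (`sum_pairs_eq`) as `E · ∑ u,
F u * χ u`, where `E` sums `χ` over the units `x` with `1 - x` a unit and `F u` sums the norms of
the gcds over the `b`'s.

Both factors reduce to orthogonality (`sum_ite_sub_one_mem`): the sum of `χ` over `x ≡ 1` mod `𝔠` is
`φ(𝔞)/φ(𝔠)` if `𝔡 ∣ 𝔠`, and `0` otherwise. This rests on `𝔡` being itself a modulus inducing `χ`.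

For `E`, inclusion-exclusion over the primes dividing `𝔞` detects that `1 - x` is a unit. Only
squarefree multiples of `𝔡` survive, whence `μ(𝔡)` and an Euler product (`exceptionalSum_eq`). The
case `χ = 1` gives the product for `φ₂`; comparing the two introduces `𝔞₀`.

For the other factor, `N(𝔟) = ∑ φ(𝔠)` over `𝔠 ∣ 𝔟` turns the gcd condition into independent
congruences. Orthogonality then cancels `φ(𝔠)` and leaves `φ(𝔞) σ_s(𝔞/𝔡)`
(`sum_mul_sum_absNorm_gcdMod`). -/

theorem isUnit_mk_iff_sup {𝔞 : Ideal R} {x : R} :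
    IsUnit (Ideal.Quotient.mk 𝔞 x) ↔ Ideal.span {x} ⊔ 𝔞 = ⊤ := by
  rw [← Ideal.span_singleton_eq_top, ← Set.image_singleton, ← Ideal.map_span,
    ← Ideal.comap_eq_top_iff (f := Ideal.Quotient.mk 𝔞),
    Ideal.comap_map_of_surjective' _ Ideal.Quotient.mk_surjective, Ideal.mk_ker]

theorem factor_eq_one_iff {𝔞 𝔠 : Ideal R} (h : 𝔞 ≤ 𝔠) (x : R ⧸ 𝔞) :
    Ideal.Quotient.factor h x = 1 ↔ x - 1 ∈ 𝔠.map (Ideal.Quotient.mk 𝔞) := by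
  obtain ⟨y, rfl⟩ := Ideal.Quotient.mk_surjective x
  rw [Ideal.Quotient.factor_mk, ← map_one (Ideal.Quotient.mk 𝔞), ← map_sub,
    Ideal.mem_quotient_iff_mem h, ← map_one (Ideal.Quotient.mk 𝔠), Ideal.Quotient.eq]

end Quotient

/-! ### Prime factors, detection and lifting of units. -/

section Dedekind

variable {R : Type*} [CommRing R] [IsDedekindDomain R]

theorem mem_primeFactors_iff {𝔞 𝔭 : Ideal R} (h𝔞 : 𝔞 ≠ ⊥) :
    𝔭 ∈ primeFactors 𝔞 ↔ Prime 𝔭 ∧ 𝔭 ∣ 𝔞 := by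
  rw [mem_primeFactors, mem_normalizedFactors_iff' h𝔞, irreducible_iff_prime]
  simp

theorem finite_divisors {𝔞 : Ideal R} (h𝔞 : 𝔞 ≠ ⊥) : {𝔠 : Ideal R | 𝔠 ∣ 𝔞}.Finite := by
  have : Fintype (Ideal R)ˣ := Fintype.ofFinite _
  have := fintypeSubtypeDvd 𝔞 h𝔞
  exact Set.finite_coe_iff.1 (inferInstanceAs (Finite {𝔠 : Ideal R // 𝔠 ∣ 𝔞}))

theorem isUnit_mk_iff {𝔞 : Ideal R} (h𝔞 : 𝔞 ≠ ⊥) {x : R} :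
    IsUnit (Ideal.Quotient.mk 𝔞 x) ↔ ∀ 𝔭 ∈ primeFactors 𝔞, x ∉ 𝔭 := by
  constructor
  · intro h 𝔭 h𝔭 hx
    obtain ⟨hp, hd⟩ := (mem_primeFactors_iff h𝔞).1 h𝔭
    have h1 := h.map (Ideal.Quotient.factor (Ideal.le_of_dvd hd))
    rw [Ideal.Quotient.factor_mk, Ideal.Quotient.eq_zero_iff_mem.2 hx, isUnit_zero_iff] at h1
    have := (Ideal.isPrime_of_prime hp).ne_top
    exact this (Ideal.Quotient.zero_eq_one_iff.1 h1)
  · intro h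
    rw [isUnit_mk_iff_sup]
    by_contra hne
    obtain ⟨M, hM, hle⟩ := Ideal.exists_le_maximal _ hne
    have hMb : M ≠ ⊥ := fun h0 => h𝔞 (le_bot_iff.1 (h0 ▸ le_sup_right.trans hle))
    refine h M ((mem_primeFactors_iff h𝔞).2
      ⟨Ideal.prime_of_isPrime hMb hM.isPrime, Ideal.dvd_iff_le.2 (le_sup_right.trans hle)⟩) ?_
    exact hle (le_sup_left (a := Ideal.span {x}) (Ideal.mem_span_singleton_self x))

theorem isCoprime_of_prime_ne {𝔭 𝔮 : Ideal R} (h𝔭 : Prime 𝔭) (h𝔮 : Prime 𝔮) (h : 𝔭 ≠ 𝔮) :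
    IsCoprime 𝔭 𝔮 := by
  have := (Ideal.isPrime_of_prime h𝔭).isMaximal h𝔭.ne_zero
  have := (Ideal.isPrime_of_prime h𝔮).isMaximal h𝔮.ne_zero
  exact Ideal.isCoprime_of_isMaximal h

theorem prod_dvd_iff {T : Finset (Ideal R)} (hT : ∀ 𝔭 ∈ T, Prime 𝔭) {𝔠 : Ideal R} :
    (∏ 𝔭 ∈ T, 𝔭) ∣ 𝔠 ↔ ∀ 𝔭 ∈ T, 𝔭 ∣ 𝔠 :=
  ⟨fun h _ h𝔭 => (Finset.dvd_prod_of_mem (fun 𝔭 => 𝔭) h𝔭).trans h, fun h =>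
    Finset.prod_dvd_of_coprime (s := fun 𝔭 => 𝔭)
      (fun _ h𝔭 _ h𝔮 hne => isCoprime_of_prime_ne (hT _ h𝔭) (hT _ h𝔮) hne) h⟩

theorem mem_prod_iff {T : Finset (Ideal R)} (hT : ∀ 𝔭 ∈ T, Prime 𝔭) {x : R} :
    x ∈ (∏ 𝔭 ∈ T, 𝔭) ↔ ∀ 𝔭 ∈ T, x ∈ 𝔭 := by
  simp only [← Ideal.dvd_span_singleton, prod_dvd_iff hT]

theorem primeFactors_prod {T : Finset (Ideal R)} (hT : ∀ 𝔭 ∈ T, Prime 𝔭) :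
    primeFactors (∏ 𝔭 ∈ T, 𝔭) = T := by
  have h0 : (∏ 𝔭 ∈ T, 𝔭) ≠ ⊥ := Finset.prod_ne_zero_iff.2 fun 𝔭 h𝔭 => (hT 𝔭 h𝔭).ne_zero
  ext 𝔮
  rw [mem_primeFactors_iff h0]
  constructor
  · rintro ⟨hq, hd⟩
    obtain ⟨𝔭, h𝔭, h⟩ := hq.exists_mem_finset_dvd hd
    rwa [associated_iff_eq.1 ((hq.dvd_prime_iff_associated (hT 𝔭 h𝔭)).1 h)]
  · exact fun h => ⟨hT _ h, Finset.dvd_prod_of_mem (fun 𝔭 => 𝔭) h⟩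

/-- The indicator function of the units of `R/𝔞` as an alternating sum over squarefree divisors. -/
theorem ite_isUnit_eq_sum {𝔞 : Ideal R} (h𝔞 : 𝔞 ≠ ⊥) (x : R ⧸ 𝔞) [Decidable (IsUnit x)]
    [∀ 𝔠 : Ideal R, Decidable (x ∈ 𝔠.map (Ideal.Quotient.mk 𝔞))] :
    (if IsUnit x then (1 : ℂ) else 0) = ∑ T ∈ (primeFactors 𝔞).powerset,
      (-1) ^ #T * if x ∈ (∏ 𝔭 ∈ T, 𝔭).map (Ideal.Quotient.mk 𝔞) then 1 else 0 := by
  classical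
  obtain ⟨y, rfl⟩ := Ideal.Quotient.mk_surjective x
  have h1 : (if IsUnit (Ideal.Quotient.mk 𝔞 y) then (1 : ℂ) else 0)
      = ∏ 𝔭 ∈ primeFactors 𝔞, (1 + -(if y ∈ 𝔭 then (1 : ℂ) else 0)) := by
    simp only [isUnit_mk_iff h𝔞]
    split_ifs with h
    · exact (Finset.prod_eq_one fun 𝔭 h𝔭 => by simp [h 𝔭 h𝔭]).symm
    · push Not at h
      obtain ⟨𝔭, h𝔭, hy⟩ := h
      exact (Finset.prod_eq_zero h𝔭 (by simp [hy])).symm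
  rw [h1, Finset.prod_one_add]
  refine Finset.sum_congr rfl fun T hT => ?_
  have hT' : ∀ 𝔭 ∈ T, Prime 𝔭 ∧ 𝔭 ∣ 𝔞 := fun 𝔭 h =>
    (mem_primeFactors_iff h𝔞).1 (Finset.mem_powerset.1 hT h)
  have hle := Ideal.le_of_dvd ((prod_dvd_iff fun 𝔭 h => (hT' 𝔭 h).1).2 fun 𝔭 h => (hT' 𝔭 h).2)
  rw [Finset.prod_neg, Finset.prod_ite_zero]
  simp only [Ideal.mem_quotient_iff_mem hle, mem_prod_iff fun 𝔭 h => (hT' 𝔭 h).1, prod_const_one]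

/-- A unit modulo a divisor `𝔠` of `𝔞` lifts to a unit modulo `𝔞`. -/
theorem exists_isUnit_mk_sub_mem {𝔞 𝔠 : Ideal R} (h𝔞 : 𝔞 ≠ ⊥) (h : 𝔠 ∣ 𝔞) {x : R}
    (hx : IsUnit (Ideal.Quotient.mk 𝔠 x)) :
    ∃ y, IsUnit (Ideal.Quotient.mk 𝔞 y) ∧ y - x ∈ 𝔠 := by
  classical
  have h𝔠 : 𝔠 ≠ ⊥ := ne_zero_of_dvd_ne_zero h𝔞 h
  let T := primeFactors 𝔞 \ primeFactors 𝔠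
  have hT : ∀ 𝔭 ∈ T, Prime 𝔭 ∧ ¬ 𝔭 ∣ 𝔠 := fun 𝔭 h𝔭 => by
    rw [Finset.mem_sdiff, mem_primeFactors_iff h𝔞, mem_primeFactors_iff h𝔠] at h𝔭
    tauto
  have hco : IsCoprime 𝔠 (∏ 𝔭 ∈ T, 𝔭) := IsCoprime.prod_right fun 𝔭 h𝔭 => by
    have hm := (Ideal.isPrime_of_prime (hT 𝔭 h𝔭).1).isMaximal (hT 𝔭 h𝔭).1.ne_zero
    rw [Ideal.isCoprime_iff_sup_eq, sup_comm]
    by_contra hne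
    exact (hT 𝔭 h𝔭).2 (Ideal.dvd_iff_le.2 (hm.eq_of_le hne le_sup_left ▸ le_sup_right))
  -- With `i + j = 1`, the element `i + j * x` is `x` mod `𝔠` and `1` modulo each prime of `𝔞` not
  -- dividing `𝔠`.
  obtain ⟨i, hi, j, hj, hij⟩ := Ideal.isCoprime_iff_exists.1 hco
  have hyx : i + j * x - x ∈ 𝔠 := by
    have : i + j * x - x = i * (1 - x) := by linear_combination (x) * hij
    rw [this]
    exact 𝔠.mul_mem_right _ hi
  refine ⟨i + j * x, (isUnit_mk_iff h𝔞).2 fun 𝔭 h𝔭 hmem => ?_, hyx⟩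
  by_cases hc : 𝔭 ∈ primeFactors 𝔠
  · have hle := Ideal.le_of_dvd ((mem_primeFactors_iff h𝔠).1 hc).2
    refine (isUnit_mk_iff h𝔠).1 hx 𝔭 hc ?_
    simpa using 𝔭.sub_mem hmem (hle hyx)
  · have hpT : 𝔭 ∈ T := Finset.mem_sdiff.2 ⟨h𝔭, hc⟩
    have hjp : j ∈ 𝔭 := (mem_prod_iff fun 𝔭 h => (hT 𝔭 h).1).1 hj 𝔭 hpT
    have hip : i ∈ 𝔭 := by simpa using 𝔭.sub_mem hmem (𝔭.mul_mem_right x hjp)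
    exact (Ideal.isPrime_of_prime (hT 𝔭 hpT).1).ne_top
      ((Ideal.eq_top_iff_one _).2 (hij ▸ 𝔭.add_mem hip hjp))

theorem units_map_factor_surjective {𝔞 𝔠 : Ideal R} (h𝔞 : 𝔞 ≠ ⊥) (h : 𝔠 ∣ 𝔞) :
    Function.Surjective (Units.map (Ideal.Quotient.factor (Ideal.le_of_dvd h) : R ⧸ 𝔞 →* R ⧸ 𝔠)) := by
  intro u
  obtain ⟨x, hx⟩ := Ideal.Quotient.mk_surjective (u : R ⧸ 𝔠)
  obtain ⟨y, hy, hyx⟩ := exists_isUnit_mk_sub_mem h𝔞 h (hx ▸ u.isUnit)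
  refine ⟨hy.unit, Units.ext ?_⟩
  simp only [Units.coe_map, IsUnit.unit_spec, MonoidHom.coe_coe, Ideal.Quotient.factor_mk, ← hx]
  exact Ideal.Quotient.eq.2 hyx

end Dedekind

/-- The units of a monoid, as a subtype of the monoid. -/
noncomputable def unitsEquivIsUnit (M : Type*) [Monoid M] : Mˣ ≃ {x : M // IsUnit x} :=
  Equiv.ofBijective (fun u => ⟨u, u.isUnit⟩)
    ⟨fun _ _ h => Units.ext (Subtype.ext_iff.1 h), fun x => ⟨x.2.unit, rfl⟩⟩

/-! ### Norms, the totient, and its divisor sum. -/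

section Counting

variable {R : Type*} [CommRing R] [IsDedekindDomain R] [Module.Free ℤ R]

theorem card_map_mul_absNorm {𝔞 𝔠 : Ideal R} (h : 𝔠 ∣ 𝔞) :
    Nat.card (𝔠.map (Ideal.Quotient.mk 𝔞)) * Ideal.absNorm 𝔠 = Ideal.absNorm 𝔞 := by
  rw [Ideal.absNorm_apply, Ideal.absNorm_apply, Submodule.cardQuot_apply, Submodule.cardQuot_apply,
    ← Submodule.card_quotient_mul_card_quotient 𝔠 𝔞 (Ideal.le_of_dvd h)]
  congr 1
  refine Nat.card_congr (Equiv.subtypeEquivRight fun x => ?_)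
  rw [Ideal.mem_map_iff_of_surjective _ Ideal.Quotient.mk_surjective, Submodule.mem_map]
  rfl

variable [Module.Finite ℤ R]

theorem absNorm_ne_zero {𝔞 : Ideal R} (h𝔞 : 𝔞 ≠ ⊥) : Ideal.absNorm 𝔞 ≠ 0 :=
  mt Ideal.absNorm_eq_zero_iff.1 h𝔞

theorem sum_ite_mem_map {𝔞 𝔠 : Ideal R} [Fintype (R ⧸ 𝔞)] (h𝔞 : 𝔞 ≠ ⊥) (h : 𝔠 ∣ 𝔞)
    [∀ x : R ⧸ 𝔞, Decidable (x ∈ 𝔠.map (Ideal.Quotient.mk 𝔞))] :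
    ∑ x : R ⧸ 𝔞, (if x ∈ 𝔠.map (Ideal.Quotient.mk 𝔞) then (1 : ℂ) else 0)
      = Ideal.absNorm 𝔞 / Ideal.absNorm 𝔠 := by
  have h0 : (Ideal.absNorm 𝔠 : ℂ) ≠ 0 :=
    Nat.cast_ne_zero.2 (absNorm_ne_zero (ne_zero_of_dvd_ne_zero h𝔞 h))
  rw [eq_div_iff h0, ← card_map_mul_absNorm h, Nat.cast_mul, Finset.sum_boole,
    ← Fintype.card_subtype, ← Nat.card_eq_fintype_card]

/-- Inclusion-exclusion for the indicator of units, summed over the residue ring: the multiples of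
`∏ 𝔭 ∈ T, 𝔭` form a fraction `∏ N(𝔭)⁻¹` of all classes. -/
theorem natCast_phi_eq {𝔞 : Ideal R} (h𝔞 : 𝔞 ≠ ⊥) :
    (phi 𝔞 : ℂ) = Ideal.absNorm 𝔞 * ∏ 𝔭 ∈ primeFactors 𝔞, (1 - (Ideal.absNorm 𝔭 : ℂ)⁻¹) := by
  classical
  have := Ideal.finiteQuotientOfFreeOfNeBot 𝔞 h𝔞
  have := Fintype.ofFinite (R ⧸ 𝔞)
  have h1 : (phi 𝔞 : ℂ) = ∑ x : R ⧸ 𝔞, if IsUnit x then (1 : ℂ) else 0 := by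
    rw [phi, Finset.sum_boole, ← Fintype.card_subtype, ← Nat.card_eq_fintype_card,
      Nat.card_congr (unitsEquivIsUnit (R ⧸ 𝔞))]
  simp only [h1, ite_isUnit_eq_sum h𝔞, sub_eq_add_neg (1 : ℂ), Finset.prod_one_add, Finset.mul_sum]
  rw [Finset.sum_comm]
  refine Finset.sum_congr rfl fun T hT => ?_
  have hT' : ∀ 𝔭 ∈ T, Prime 𝔭 ∧ 𝔭 ∣ 𝔞 := fun 𝔭 h =>
    (mem_primeFactors_iff h𝔞).1 (Finset.mem_powerset.1 hT h)
  have hd := (prod_dvd_iff fun 𝔭 h => (hT' 𝔭 h).1).2 fun 𝔭 h => (hT' 𝔭 h).2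
  rw [← Finset.mul_sum, sum_ite_mem_map h𝔞 hd, Finset.prod_neg, map_prod, Nat.cast_prod,
    Finset.prod_inv_distrib]
  ring

theorem phi_pos {𝔞 : Ideal R} (h𝔞 : 𝔞 ≠ ⊥) : 0 < phi 𝔞 := by
  have := Ideal.finiteQuotientOfFreeOfNeBot 𝔞 h𝔞
  exact Nat.card_pos

theorem natCast_phi_ne_zero {𝔞 : Ideal R} (h𝔞 : 𝔞 ≠ ⊥) : (phi 𝔞 : ℂ) ≠ 0 :=
  Nat.cast_ne_zero.2 (phi_pos h𝔞).ne'

theorem natCast_phi_mul {𝔞 𝔟 : Ideal R} (h𝔞 : 𝔞 ≠ ⊥) (h𝔟 : 𝔟 ≠ ⊥) (h : IsCoprime 𝔞 𝔟) :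
    (phi (𝔞 * 𝔟) : ℂ) = phi 𝔞 * phi 𝔟 := by
  classical
  rw [natCast_phi_eq h𝔞, natCast_phi_eq h𝔟, natCast_phi_eq (mul_ne_zero h𝔞 h𝔟),
    primeFactors_mul_eq_union h𝔞 h𝔟, Finset.prod_union (disjoint_primeFactors h.isRelPrime)]
  push_cast [map_mul]
  ring

theorem natCast_phi_prod {T : Finset (Ideal R)} (hT : ∀ 𝔭 ∈ T, Prime 𝔭) :
    (phi (∏ 𝔭 ∈ T, 𝔭) : ℂ) = ∏ 𝔭 ∈ T, (phi 𝔭 : ℂ) := by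
  classical
  have h0 : ∀ {S : Finset (Ideal R)}, (∀ 𝔭 ∈ S, Prime 𝔭) → (∏ 𝔭 ∈ S, 𝔭) ≠ ⊥ :=
    fun hS => Finset.prod_ne_zero_iff.2 fun 𝔭 h𝔭 => (hS 𝔭 h𝔭).ne_zero
  rw [natCast_phi_eq (h0 hT), primeFactors_prod hT, map_prod, Nat.cast_prod,
    ← Finset.prod_mul_distrib]
  refine Finset.prod_congr rfl fun 𝔭 h𝔭 => ?_
  have h1 := primeFactors_prod (T := {𝔭}) (by simpa using hT 𝔭 h𝔭)
  rw [Finset.prod_singleton] at h1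
  rw [natCast_phi_eq (hT 𝔭 h𝔭).ne_zero, h1, Finset.prod_singleton]

open Ideal in
-- The classes killed by `𝔠` form `𝔢/𝔠𝔢`, which is cyclic and isomorphic to `R/𝔠`; those with
-- annihilator exactly `𝔠` correspond to the units of `R/𝔠`.
theorem card_torsionOf_eq {𝔠 𝔢 : Ideal R} (h0 : 𝔠 * 𝔢 ≠ ⊥) :
    Nat.card {y : R ⧸ (𝔠 * 𝔢) // torsionOf R (R ⧸ (𝔠 * 𝔢)) y = 𝔠} = phi 𝔠 := by
  have h𝔠 : 𝔠 ≠ ⊥ := left_ne_zero_of_mul h0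
  have h𝔢 : 𝔢 ≠ ⊥ := right_ne_zero_of_mul h0
  have := Ideal.finiteQuotientOfFreeOfNeBot 𝔠 h𝔠
  -- `x` generates `𝔢` modulo `𝔠 * 𝔢`; multiplication by `x` will embed `R/𝔠`.
  obtain ⟨x, hx⟩ := IsDedekindDomain.exists_sup_span_eq (Ideal.mul_le_right : 𝔠 * 𝔢 ≤ 𝔢) h0
  have hxe : x ∈ 𝔢 := hx ▸ Ideal.mem_sup_right (Ideal.mem_span_singleton_self x)
  have key : ∀ t, t * x ∈ 𝔠 * 𝔢 ↔ t ∈ 𝔠 := fun t => by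
    refine ⟨fun h => ?_, fun h => Ideal.mul_mem_mul h hxe⟩
    have h1 : Ideal.span {t} * 𝔢 ≤ 𝔠 * 𝔢 := by
      rw [← hx, Ideal.mul_sup, Ideal.span_singleton_mul_span_singleton, hx]
      exact sup_le Ideal.mul_le_right ((Ideal.span_singleton_le_iff_mem _).2 h)
    rw [← Ideal.dvd_iff_le, mul_dvd_mul_iff_right h𝔢] at h1
    exact Ideal.dvd_span_singleton.1 h1
  let g : R ⧸ 𝔠 →ₗ[R] R ⧸ (𝔠 * 𝔢) := Submodule.mapQ 𝔠 (𝔠 * 𝔢) (LinearMap.mulRight R x)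
    fun t ht => (key t).2 ht
  have hg : ∀ r, g (Ideal.Quotient.mk 𝔠 r) = Ideal.Quotient.mk (𝔠 * 𝔢) (r * x) := fun r => rfl
  have hsmul : ∀ t r : R, t • g (Ideal.Quotient.mk 𝔠 r) = 0 ↔ t * r ∈ 𝔠 := fun t r => by
    rw [hg, ← key, ← Ideal.Quotient.eq_zero_iff_mem, mul_assoc, map_mul _ t]
    rfl
  have hinj : Function.Injective g := by
    rw [injective_iff_map_eq_zero]
    intro z hz
    obtain ⟨r, rfl⟩ := Ideal.Quotient.mk_surjective z
    rw [Ideal.Quotient.eq_zero_iff_mem, ← one_mul r, ← hsmul, hz, smul_zero]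
  have htors : ∀ z : R ⧸ 𝔠, torsionOf R (R ⧸ (𝔠 * 𝔢)) (g z) = 𝔠 ↔ IsUnit z := fun z => by
    obtain ⟨r, rfl⟩ := Ideal.Quotient.mk_surjective z
    constructor
    · intro h
      rw [isUnit_iff_mem_nonZeroDivisors_of_finite, mem_nonZeroDivisors_iff_right]
      intro w hw
      obtain ⟨t, rfl⟩ := Ideal.Quotient.mk_surjective w
      rw [← map_mul, Ideal.Quotient.eq_zero_iff_mem, ← hsmul, ← mem_torsionOf_iff, h] at hw
      exact Ideal.Quotient.eq_zero_iff_mem.2 hw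
    · intro h
      ext t
      rw [mem_torsionOf_iff, hsmul, ← Ideal.Quotient.eq_zero_iff_mem, map_mul, h.mul_left_eq_zero,
        Ideal.Quotient.eq_zero_iff_mem]
  let f : (R ⧸ 𝔠)ˣ → {y : R ⧸ (𝔠 * 𝔢) // torsionOf R (R ⧸ (𝔠 * 𝔢)) y = 𝔠} :=
    fun u => ⟨g u, (htors u).2 u.isUnit⟩
  have hf : Function.Injective f := fun u v huv => Units.ext (hinj (Subtype.ext_iff.1 huv))
  refine (Nat.card_congr (Equiv.ofBijective f ⟨hf, fun ⟨y, hy⟩ => ?_⟩)).symm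
  obtain ⟨y, rfl⟩ := Ideal.Quotient.mk_surjective y
  -- Since `𝔠` kills `y`, the ideal `𝔠 * (y)` lies in `𝔠 * 𝔢`, and `𝔠` cancels.
  have hye : y ∈ 𝔢 := by
    have h1 : 𝔠 * Ideal.span {y} ≤ 𝔠 * 𝔢 := by
      rw [Ideal.mul_le]
      intro c hc z hz
      obtain ⟨a, rfl⟩ := Ideal.mem_span_singleton'.1 hz
      rw [← hy, mem_torsionOf_iff] at hc
      have : c * y ∈ 𝔠 * 𝔢 := Ideal.Quotient.eq_zero_iff_mem.1 (by rw [map_mul]; exact hc)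
      rw [mul_left_comm]
      exact Ideal.mul_mem_left _ a this
    rw [← Ideal.dvd_iff_le, mul_dvd_mul_iff_left h𝔠] at h1
    exact Ideal.dvd_span_singleton.1 h1
  rw [← hx] at hye
  obtain ⟨i, hi, z, hz, rfl⟩ := Submodule.mem_sup.1 hye
  obtain ⟨r, rfl⟩ := Ideal.mem_span_singleton'.1 hz
  have hgr : Ideal.Quotient.mk (𝔠 * 𝔢) (i + r * x) = g (Ideal.Quotient.mk 𝔠 r) := by
    rw [hg, map_add, Ideal.Quotient.eq_zero_iff_mem.2 hi, zero_add]
  rw [hgr] at hy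
  exact ⟨((htors _).1 hy).unit, Subtype.ext hgr.symm⟩

/-- Gauss's identity: sort the classes mod `𝔟` by their annihilator. -/
theorem sum_phi_eq_absNorm {𝔟 : Ideal R} (h : 𝔟 ≠ ⊥) :
    ∑ 𝔠 ∈ (finite_divisors h).toFinset, phi 𝔠 = Ideal.absNorm 𝔟 := by
  classical
  have := Ideal.finiteQuotientOfFreeOfNeBot 𝔟 h
  have := Fintype.ofFinite (R ⧸ 𝔟)
  rw [Ideal.absNorm_apply, Submodule.cardQuot_apply, Nat.card_eq_fintype_card, ← Finset.card_univ,
    Finset.card_eq_sum_card_fiberwise (f := Ideal.torsionOf R (R ⧸ 𝔟))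
      (t := (finite_divisors h).toFinset)]
  · refine Finset.sum_congr rfl fun 𝔠 h𝔠 => ?_
    obtain ⟨𝔢, rfl⟩ : 𝔠 ∣ 𝔟 := by simpa using h𝔠
    rw [← card_torsionOf_eq h, ← Fintype.card_subtype, ← Nat.card_eq_fintype_card]
  · intro y _
    obtain ⟨y, rfl⟩ := Ideal.Quotient.mk_surjective y
    simp only [Set.Finite.coe_toFinset, Set.mem_ofPred_eq, Ideal.dvd_iff_le]
    intro t ht
    rw [Ideal.mem_torsionOf_iff]
    exact Ideal.Quotient.eq_zero_iff_mem.2 (𝔟.mul_mem_right y ht)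

end Counting

/-! ### Splitting the sum over pairs. -/

section Quotient

variable {R : Type*} [CommRing R]

theorem factorsThrough_self {𝔞 : Ideal R} (χ : DirichletChar 𝔞) : FactorsThrough χ 𝔞 :=
  ⟨dvd_rfl, χ, fun u => by
    obtain ⟨x, hx⟩ := Ideal.Quotient.mk_surjective (u : R ⧸ 𝔞)
    rw [← hx, Ideal.Quotient.factor_mk]⟩

open Classical in
/-- The sum of `χ` over the exceptional units `x` of `R/𝔞`, that is, those with `1 - x` a unit. -/
noncomputable def exceptionalSum {𝔞 : Ideal R} [Fintype (R ⧸ 𝔞)] (χ : DirichletChar 𝔞) : ℂ :=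
  ∑ x : R ⧸ 𝔞, if IsUnit (1 - x) then χ x else 0

open Classical in
theorem sum_pairs_eq {𝔞 : Ideal R} [Fintype (R ⧸ 𝔞)] (χ : DirichletChar 𝔞) (F : R ⧸ 𝔞 → ℂ) :
    ∑ a₁ : R ⧸ 𝔞, ∑ a₂ : R ⧸ 𝔞,
      (if IsUnit (a₁ * a₂) ∧ IsUnit (a₁ + a₂) then F (a₁ + a₂) * χ a₁ else 0)
      = exceptionalSum χ * ∑ u : R ⧸ 𝔞, F u * χ u := by
  have h1 : ∀ a₁ : R ⧸ 𝔞, ∑ a₂ : R ⧸ 𝔞,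
      (if IsUnit (a₁ * a₂) ∧ IsUnit (a₁ + a₂) then F (a₁ + a₂) * χ a₁ else 0)
      = ∑ u : R ⧸ 𝔞, if IsUnit (u - a₁) ∧ IsUnit u then F u * χ a₁ else 0 := fun a₁ => by
    -- Substitute `u = a₁ + a₂`.
    refine Eq.trans ?_ (Equiv.sum_comp (Equiv.addLeft a₁) _)
    refine Finset.sum_congr rfl fun a₂ _ => ?_
    by_cases h : IsUnit a₁
    · simp [IsUnit.mul_iff, h]
    · simp [χ.map_nonunit h]
  rw [Finset.sum_congr rfl fun a₁ _ => h1 a₁, Finset.sum_comm, Finset.mul_sum]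
  refine Finset.sum_congr rfl fun u _ => ?_
  by_cases hu : IsUnit u
  · obtain ⟨w, rfl⟩ := hu
    rw [exceptionalSum, Finset.sum_mul]
    -- Substitute `a₁ = w * x`; multiplicativity of `χ` separates `x` from `w`.
    refine (Equiv.sum_comp (Units.mulLeft w) _).symm.trans ?_
    refine Finset.sum_congr rfl fun x _ => ?_
    have : (w : R ⧸ 𝔞) - w * x = w * (1 - x) := by ring
    simp only [Units.mulLeft_apply, this, IsUnit.mul_iff, Units.isUnit, true_and, and_true,
      map_mul]
    split_ifs <;> ring
  · simp [hu, χ.map_nonunit hu]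

/-- The case `χ = 1`, `F = 1` of `sum_pairs_eq`. -/
theorem natCast_phi₂_eq {𝔞 : Ideal R} [Fintype (R ⧸ 𝔞)] :
    (phi₂ 𝔞 : ℂ) = phi 𝔞 * exceptionalSum (1 : DirichletChar 𝔞) := by
  classical
  have h1 := sum_pairs_eq (1 : DirichletChar 𝔞) (fun _ => 1)
  have hphi : ∑ u : R ⧸ 𝔞, (1 : ℂ) * (1 : DirichletChar 𝔞) u = phi 𝔞 := by
    simp only [one_mul, phi, MulChar.sum_one_eq_card_units, Nat.card_eq_fintype_card]
  rw [hphi, mul_comm] at h1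
  rw [← h1, phi₂, Nat.card_eq_fintype_card, Fintype.card_subtype, ← Finset.sum_boole,
    ← Finset.univ_product_univ, Finset.sum_product]
  have key : ∀ G : R ⧸ 𝔞 → ℂ, (∀ x, ¬ IsUnit x → G x = 0) →
      ∑ u : (R ⧸ 𝔞)ˣ, G u = ∑ x : R ⧸ 𝔞, G x := fun G hG =>
    Finset.sum_of_injOn (fun u : (R ⧸ 𝔞)ˣ => (u : R ⧸ 𝔞)) (Units.val_injective.injOn)
      (fun _ _ => Finset.mem_coe.2 (Finset.mem_univ _))
      (fun x _ hx => hG x fun hu => hx ⟨hu.unit, by simp, rfl⟩) (fun u _ => rfl)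
  rw [← key]
  · refine Finset.sum_congr rfl fun u _ => ?_
    rw [← key]
    · refine Finset.sum_congr rfl fun v _ => ?_
      simp [IsUnit.mul_iff]
    · intro x hx
      simp [IsUnit.mul_iff, hx]
  · intro x hx
    simp [IsUnit.mul_iff, hx]

end Quotient

/-! ### Conductors and orthogonality. -/

section Character

variable {R : Type*} [CommRing R] [IsDedekindDomain R]

/-- Reduction of units is surjective, so a character descends exactly when it is trivial on the
kernel. -/
theorem factorsThrough_iff {𝔞 : Ideal R} (h𝔞 : 𝔞 ≠ ⊥) (χ : DirichletChar 𝔞) (𝔠 : Ideal R) :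
    FactorsThrough χ 𝔠 ↔ 𝔠 ∣ 𝔞 ∧
      ∀ u : (R ⧸ 𝔞)ˣ, (u : R ⧸ 𝔞) - 1 ∈ 𝔠.map (Ideal.Quotient.mk 𝔞) → χ u = 1 := by
  constructor
  · rintro ⟨h, ψ, hψ⟩
    refine ⟨h, fun u hu => ?_⟩
    rw [hψ, (factor_eq_one_iff (Ideal.le_of_dvd h) _).2 hu, map_one]
  · rintro ⟨h, hχ⟩
    let π : (R ⧸ 𝔞)ˣ →* (R ⧸ 𝔠)ˣ :=
      Units.map (Ideal.Quotient.factor (Ideal.le_of_dvd h) : R ⧸ 𝔞 →* R ⧸ 𝔠)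
    have hπ : Function.Surjective π := units_map_factor_surjective h𝔞 h
    have hker : π.ker ≤ χ.toUnitHom.ker := fun u hu => by
      rw [MonoidHom.mem_ker] at hu ⊢
      refine Units.ext ?_
      rw [MulChar.coe_toUnitHom, Units.val_one]
      exact hχ u ((factor_eq_one_iff (Ideal.le_of_dvd h) _).1 (congrArg Units.val hu))
    refine ⟨h, MulChar.ofUnitHom (π.liftOfSurjective hπ ⟨χ.toUnitHom, hker⟩), fun u => ?_⟩
    change χ u = MulChar.ofUnitHom _ ((π u : (R ⧸ 𝔠)ˣ) : R ⧸ 𝔠)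
    rw [MulChar.ofUnitHom_coe, MonoidHom.liftOfRightInverse_comp_apply, MulChar.coe_toUnitHom]

theorem FactorsThrough.of_dvd {𝔞 𝔠 𝔪 : Ideal R} (h𝔞 : 𝔞 ≠ ⊥) {χ : DirichletChar 𝔞}
    (h : FactorsThrough χ 𝔪) (h1 : 𝔪 ∣ 𝔠) (h2 : 𝔠 ∣ 𝔞) : FactorsThrough χ 𝔠 := by
  rw [factorsThrough_iff h𝔞] at h ⊢
  exact ⟨h2, fun u hu => h.2 u (Ideal.map_mono (Ideal.le_of_dvd h1) hu)⟩

/-- A unit `x ≡ 1` mod `𝔠 ⊔ 𝔪` is linked to `1` through a unit `y` with `y ≡ 1` mod `𝔠` and `y ≡ x`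
mod `𝔪`, so `χ(x) = χ(y) = 1`. -/
theorem FactorsThrough.sup {𝔞 𝔠 𝔪 : Ideal R} (h𝔞 : 𝔞 ≠ ⊥) {χ : DirichletChar 𝔞}
    (h𝔠 : FactorsThrough χ 𝔠) (h𝔪 : FactorsThrough χ 𝔪) : FactorsThrough χ (𝔠 ⊔ 𝔪) := by
  rw [factorsThrough_iff h𝔞] at h𝔠 h𝔪 ⊢
  have hc := Ideal.le_of_dvd h𝔠.1
  have hm := Ideal.le_of_dvd h𝔪.1
  have hs : 𝔞 ≤ 𝔠 ⊔ 𝔪 := hc.trans le_sup_left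
  have hi : 𝔞 ≤ 𝔠 ⊓ 𝔪 := le_inf hc hm
  have hib : 𝔠 ⊓ 𝔪 ≠ ⊥ := fun h => h𝔞 (le_bot_iff.1 (h ▸ hi))
  refine ⟨Ideal.dvd_iff_le.2 hs, fun u hu => ?_⟩
  obtain ⟨x, hx⟩ := Ideal.Quotient.mk_surjective (u : R ⧸ 𝔞)
  rw [← hx, ← map_one (Ideal.Quotient.mk 𝔞), ← map_sub, Ideal.mem_quotient_iff_mem hs] at hu
  obtain ⟨c, hcm, m, hmm, hcm'⟩ := Submodule.mem_sup.1 hu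
  have hxu : IsUnit (Ideal.Quotient.mk 𝔞 x) := hx ▸ u.isUnit
  -- A prime containing `𝔠 ⊓ 𝔪` contains `𝔠`, where `1 + c ≡ 1`, or `𝔪`, where `1 + c ≡ x`.
  have hw0 : IsUnit (Ideal.Quotient.mk (𝔠 ⊓ 𝔪) (1 + c)) := by
    refine (isUnit_mk_iff hib).2 fun 𝔭 h𝔭 hmem => ?_
    obtain ⟨hp, hd⟩ := (mem_primeFactors_iff hib).1 h𝔭
    have hP := Ideal.isPrime_of_prime hp
    rcases hP.inf_le.1 (Ideal.le_of_dvd hd) with hle | hle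
    · exact hP.ne_top ((Ideal.eq_top_iff_one _).2 (by simpa using 𝔭.sub_mem hmem (hle hcm)))
    · refine (isUnit_mk_iff h𝔞).1 hxu 𝔭
        ((mem_primeFactors_iff h𝔞).2 ⟨hp, Ideal.dvd_iff_le.2 (hm.trans hle)⟩) ?_
      have : x = 1 + c + m := by linear_combination -hcm'
      exact this ▸ 𝔭.add_mem hmem (hle hmm)
  obtain ⟨y, hy, hyc⟩ := exists_isUnit_mk_sub_mem h𝔞 (Ideal.dvd_iff_le.2 hi) hw0
  have h1 : χ (Ideal.Quotient.mk 𝔞 y) = 1 := by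
    refine h𝔠.2 hy.unit ?_
    rw [IsUnit.unit_spec, ← map_one (Ideal.Quotient.mk 𝔞), ← map_sub,
      Ideal.mem_quotient_iff_mem hc]
    have : y - 1 = y - (1 + c) + c := by ring
    exact this ▸ 𝔠.add_mem hyc.1 hcm
  have h2 : χ ((u⁻¹ * hy.unit : (R ⧸ 𝔞)ˣ) : R ⧸ 𝔞) = 1 := by
    refine h𝔪.2 _ ?_
    have : ((u⁻¹ * hy.unit : (R ⧸ 𝔞)ˣ) : R ⧸ 𝔞) - 1
        = ((u⁻¹ : (R ⧸ 𝔞)ˣ) : R ⧸ 𝔞) * Ideal.Quotient.mk 𝔞 (y - x) := by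
      rw [map_sub, hx, mul_sub, Units.inv_mul, Units.val_mul, IsUnit.unit_spec]
    rw [this]
    refine Ideal.mul_mem_left _ _ ((Ideal.mem_quotient_iff_mem hm).2 ?_)
    have : y - x = y - (1 + c) - m := by linear_combination hcm'
    exact this ▸ 𝔪.sub_mem hyc.2 hmm
  have h3 : χ (u : R ⧸ 𝔞) * χ ((u⁻¹ * hy.unit : (R ⧸ 𝔞)ˣ) : R ⧸ 𝔞) = 1 := by
    rw [← map_mul, ← Units.val_mul, mul_inv_cancel_left, IsUnit.unit_spec, h1]
  rwa [h2, mul_one] at h3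

/-- The inducing moduli are closed under `⊔`, so in a Noetherian ring a maximal one is the largest.
-/
theorem factorsThrough_conductor {𝔞 : Ideal R} (h𝔞 : 𝔞 ≠ ⊥) (χ : DirichletChar 𝔞) :
    FactorsThrough χ (conductor χ) := by
  obtain ⟨𝔪, h𝔪, hmax⟩ := set_has_maximal_iff_noetherian.2 (inferInstance : IsNoetherian R R)
    {𝔪 : Ideal R | FactorsThrough χ 𝔪} ⟨𝔞, factorsThrough_self χ⟩
  have : conductor χ = 𝔪 := by
    refine le_antisymm (sSup_le fun 𝔠 h𝔠 => ?_) (le_sSup h𝔪)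
    have h1 := hmax _ (FactorsThrough.sup h𝔞 h𝔪 h𝔠)
    exact le_sup_right.trans (not_lt_iff_le_imp_ge.1 h1 le_sup_left)
  exact this ▸ h𝔪

theorem conductor_dvd {𝔞 : Ideal R} (h𝔞 : 𝔞 ≠ ⊥) (χ : DirichletChar 𝔞) : conductor χ ∣ 𝔞 :=
  (factorsThrough_conductor h𝔞 χ).1

theorem factorsThrough_iff_conductor_dvd {𝔞 𝔠 : Ideal R} (h𝔞 : 𝔞 ≠ ⊥) {χ : DirichletChar 𝔞}
    (h : 𝔠 ∣ 𝔞) : FactorsThrough χ 𝔠 ↔ conductor χ ∣ 𝔠 :=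
  ⟨fun h1 => Ideal.dvd_iff_le.2 (le_sSup h1), fun h1 =>
    (factorsThrough_conductor h𝔞 χ).of_dvd h𝔞 h1 h⟩

theorem conductor_one {𝔞 : Ideal R} (h𝔞 : 𝔞 ≠ ⊥) : conductor (1 : DirichletChar 𝔞) = 1 := by
  refine isUnit_iff_eq_one.1 (isUnit_of_dvd_one
    ((factorsThrough_iff_conductor_dvd h𝔞 (one_dvd _)).1 ?_))
  exact (factorsThrough_iff h𝔞 _ _).2 ⟨one_dvd _, fun u _ => MulChar.one_apply_coe u⟩

/-- Orthogonality: the sum of `χ` over the residue classes congruent to `1` modulo `𝔠`. -/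
theorem sum_ite_sub_one_mem {𝔞 𝔠 : Ideal R} (h𝔞 : 𝔞 ≠ ⊥) [Fintype (R ⧸ 𝔞)] (χ : DirichletChar 𝔞)
    (h : 𝔠 ∣ 𝔞) (h𝔠 : (phi 𝔠 : ℂ) ≠ 0) [Decidable (conductor χ ∣ 𝔠)]
    [∀ x : R ⧸ 𝔞, Decidable (x - 1 ∈ 𝔠.map (Ideal.Quotient.mk 𝔞))] :
    ∑ x : R ⧸ 𝔞, (if x - 1 ∈ 𝔠.map (Ideal.Quotient.mk 𝔞) then χ x else 0)
      = if conductor χ ∣ 𝔠 then (phi 𝔞 : ℂ) / phi 𝔠 else 0 := by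
  classical
  simp only [← factorsThrough_iff_conductor_dvd h𝔞 h, factorsThrough_iff h𝔞, h, true_and]
  split_ifs with hχ
  · let π : (R ⧸ 𝔞)ˣ →* (R ⧸ 𝔠)ˣ :=
      Units.map (Ideal.Quotient.factor (Ideal.le_of_dvd h) : R ⧸ 𝔞 →* R ⧸ 𝔠)
    have hπ : Function.Surjective π := units_map_factor_surjective h𝔞 h
    have hcard : Nat.card π.ker * phi 𝔠 = phi 𝔞 := by
      have h1 := π.ker.card_mul_index
      rwa [Subgroup.index_ker, MonoidHom.range_eq_top.2 hπ, Subgroup.card_top] at h1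
    have hmem : ∀ u : (R ⧸ 𝔞)ˣ,
        u ∈ π.ker ↔ (u : R ⧸ 𝔞) - 1 ∈ 𝔠.map (Ideal.Quotient.mk 𝔞) := fun u => by
      rw [← factor_eq_one_iff (Ideal.le_of_dvd h), MonoidHom.mem_ker, Units.ext_iff]
      rfl
    rw [eq_div_iff h𝔠, ← hcard, Nat.cast_mul]
    congr 1
    rw [Nat.card_eq_fintype_card, Fintype.card_subtype, ← Finset.sum_boole]
    symm
    refine Finset.sum_of_injOn (fun u : (R ⧸ 𝔞)ˣ => (u : R ⧸ 𝔞)) (Units.val_injective.injOn)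
      (fun _ _ => Finset.mem_coe.2 (Finset.mem_univ _)) (fun x _ hx => ?_) (fun u _ => ?_)
    · have : ¬ IsUnit x := fun hu => hx ⟨hu.unit, by simp, rfl⟩
      simp [χ.map_nonunit this]
    · simp only [hmem]
      split_ifs with hu
      · exact (hχ u hu).symm
      · rfl
  -- Multiplication by some `w ≡ 1` mod `𝔠` with `χ w ≠ 1` permutes the range of summation, so the
  -- sum vanishes.
  · push Not at hχ
    obtain ⟨w, hw, hw1⟩ := hχ
    have h1 : χ w * ∑ x : R ⧸ 𝔞, (if x - 1 ∈ 𝔠.map (Ideal.Quotient.mk 𝔞) then χ x else 0)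
        = ∑ x : R ⧸ 𝔞, (if x - 1 ∈ 𝔠.map (Ideal.Quotient.mk 𝔞) then χ x else 0) := by
      rw [Finset.mul_sum]
      refine Eq.trans ?_ (Equiv.sum_comp (Units.mulLeft w) _)
      refine Finset.sum_congr rfl fun x _ => ?_
      have : (w : R ⧸ 𝔞) * x - 1 ∈ 𝔠.map (Ideal.Quotient.mk 𝔞) ↔
          x - 1 ∈ 𝔠.map (Ideal.Quotient.mk 𝔞) := by
        have e : (w : R ⧸ 𝔞) * x - 1 = x * (w - 1) + (x - 1) := by ring
        rw [e, Ideal.add_mem_iff_right _ (Ideal.mul_mem_left _ _ hw)]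
      simp only [Units.mulLeft_apply, this, map_mul, mul_ite, mul_zero]
    have h2 : (χ w - 1) * ∑ x : R ⧸ 𝔞,
        (if x - 1 ∈ 𝔠.map (Ideal.Quotient.mk 𝔞) then χ x else 0) = 0 := by
      rw [sub_mul, h1, one_mul, sub_self]
    exact (mul_eq_zero.1 h2).resolve_left (sub_ne_zero.2 hw1)

end Character

theorem le_gcdMod {R : Type*} [CommRing R] {𝔞 : Ideal R} {ι : Type*} (x : ι → R ⧸ 𝔞) :
    𝔞 ≤ gcdMod 𝔞 x := fun y hy => by
  rw [gcdMod, Ideal.mem_comap, Ideal.Quotient.eq_zero_iff_mem.2 hy]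
  exact zero_mem _

/-- Divisibility of the gcd is a condition on each coordinate separately, which lets the sum over
`b` factor. -/
theorem gcdMod_le_iff {R : Type*} [CommRing R] {𝔞 𝔠 : Ideal R} (h : 𝔞 ≤ 𝔠) {ι : Type*}
    (x : ι → R ⧸ 𝔞) : gcdMod 𝔞 x ≤ 𝔠 ↔ ∀ i, x i ∈ 𝔠.map (Ideal.Quotient.mk 𝔞) := by
  have h1 : 𝔠 = (𝔠.map (Ideal.Quotient.mk 𝔞)).comap (Ideal.Quotient.mk 𝔞) := by
    ext y
    rw [Ideal.mem_comap, Ideal.mem_quotient_iff_mem h]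
  conv_lhs => rw [h1, gcdMod, Ideal.comap_le_comap_iff_of_surjective _ Ideal.Quotient.mk_surjective,
    Ideal.span_le]
  exact Set.range_subset_iff

/-! ### Exact quotients, the Möbius function and `sigma`. -/

section Dedekind

variable {R : Type*} [CommRing R] [IsDedekindDomain R]

theorem div_ne_bot {𝔞 𝔠 : Ideal R} (h𝔞 : 𝔞 ≠ ⊥) (h : 𝔠 ∣ 𝔞) : 𝔞 / 𝔠 ≠ ⊥ := fun h0 =>
  h𝔞 (by rw [← div_mul_cancel_of_dvd h, h0, Ideal.bot_mul])

theorem div_dvd {𝔞 𝔠 : Ideal R} (h : 𝔠 ∣ 𝔞) : 𝔞 / 𝔠 ∣ 𝔞 :=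
  ⟨𝔠, (div_mul_cancel_of_dvd h).symm⟩

theorem div_div_cancel_of_dvd {𝔞 𝔠 : Ideal R} (h𝔞 : 𝔞 ≠ ⊥) (h : 𝔠 ∣ 𝔞) : 𝔞 / (𝔞 / 𝔠) = 𝔠 := by
  refine mul_right_cancel₀ (div_ne_bot h𝔞 h) ?_
  rw [div_mul_cancel_of_dvd (div_dvd h), mul_comm, div_mul_cancel_of_dvd h]

theorem dvd_div_iff_mul_dvd {𝔞 𝔠 𝔡 : Ideal R} (h𝔞 : 𝔞 ≠ ⊥) (h : 𝔡 ∣ 𝔞) :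
    𝔠 ∣ 𝔞 / 𝔡 ↔ 𝔠 * 𝔡 ∣ 𝔞 := by
  conv_rhs => rw [← div_mul_cancel_of_dvd h]
  exact (mul_dvd_mul_iff_right (ne_zero_of_dvd_ne_zero h𝔞 h)).symm

theorem squarefree_prod {T : Finset (Ideal R)} (hT : ∀ 𝔭 ∈ T, Prime 𝔭) :
    Squarefree (∏ 𝔭 ∈ T, 𝔭) :=
  Finset.squarefree_prod_of_pairwise_isCoprime
    (fun _ h𝔭 _ h𝔮 hne => (isCoprime_of_prime_ne (hT _ h𝔭) (hT _ h𝔮) hne).isRelPrime)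
    fun 𝔭 h𝔭 => (hT 𝔭 h𝔭).squarefree

theorem prod_primeFactors_of_squarefree {𝔡 : Ideal R} (h : Squarefree 𝔡) :
    ∏ 𝔭 ∈ primeFactors 𝔡, 𝔭 = 𝔡 :=
  associated_iff_eq.1 (radical_associated h.isRadical h.ne_zero)

theorem moebius_prod {T : Finset (Ideal R)} (hT : ∀ 𝔭 ∈ T, Prime 𝔭) :
    moebius (∏ 𝔭 ∈ T, 𝔭) = (-1) ^ #T := by
  classical
  induction T using Finset.induction_on with
  | empty => rw [Finset.prod_empty, moebius_one, Finset.card_empty, pow_zero]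
  | insert 𝔮 S h𝔮 ih =>
    have hq := hT 𝔮 (Finset.mem_insert_self _ _)
    have hS : ∀ 𝔭 ∈ S, Prime 𝔭 := fun 𝔭 h => hT 𝔭 (Finset.mem_insert_of_mem h)
    rw [Finset.prod_insert h𝔮, IsRelPrime.moebius_mul, hq.irreducible.moebius_eq, ih hS,
      Finset.card_insert_of_notMem h𝔮, pow_succ']
    refine (IsCoprime.prod_right fun 𝔭 h𝔭 => isCoprime_of_prime_ne hq (hS 𝔭 h𝔭) ?_).isRelPrime
    rintro rfl
    exact h𝔮 h𝔭

variable [Module.Free ℤ R]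

open Classical in
-- The involution `𝔠 ↦ 𝔞 / 𝔠` exchanges divisors of `𝔞 / 𝔡` with divisors of `𝔞` that are multiples
-- of `𝔡`, the form orthogonality produces.
theorem natCast_sigma_div {𝔞 𝔡 : Ideal R} (h𝔞 : 𝔞 ≠ ⊥) (h : 𝔡 ∣ 𝔞) (s : ℕ) :
    (sigma s (𝔞 / 𝔡) : ℂ) = ∑ 𝔠 ∈ (finite_divisors h𝔞).toFinset,
      if 𝔡 ∣ 𝔠 then (Ideal.absNorm (𝔞 / 𝔠) : ℂ) ^ s else 0 := by
  have h1 : sigma s (𝔞 / 𝔡)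
      = ∑ 𝔠 ∈ (finite_divisors (div_ne_bot h𝔞 h)).toFinset, Ideal.absNorm 𝔠 ^ s :=
    finsum_mem_eq_finite_toFinset_sum _ (finite_divisors (div_ne_bot h𝔞 h))
  rw [h1, ← Finset.sum_filter, Nat.cast_sum]
  refine Finset.sum_nbij' (fun 𝔠 => 𝔞 / 𝔠) (fun 𝔠 => 𝔞 / 𝔠) ?_ ?_ ?_ ?_ ?_ <;>
    simp only [Finset.mem_filter, Set.Finite.mem_toFinset, Set.mem_ofPred_eq,
      dvd_div_iff_mul_dvd h𝔞 h]
  · intro 𝔠 hc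
    have hc' := (dvd_mul_right _ _).trans hc
    refine ⟨div_dvd hc', ?_⟩
    rw [dvd_div_iff_mul_dvd h𝔞 hc', mul_comm]
    exact hc
  · rintro 𝔠 ⟨hc, hd⟩
    have := mul_dvd_mul_left (𝔞 / 𝔠) hd
    rwa [div_mul_cancel_of_dvd hc] at this
  · exact fun 𝔠 hc => div_div_cancel_of_dvd h𝔞 ((dvd_mul_right _ _).trans hc)
  · exact fun 𝔠 hc => div_div_cancel_of_dvd h𝔞 hc.1
  · intro 𝔠 hc
    rw [div_div_cancel_of_dvd h𝔞 ((dvd_mul_right _ _).trans hc), Nat.cast_pow]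

/-! ### The character sum over exceptional units. -/

variable [Module.Finite ℤ R]

/-- After inclusion-exclusion and orthogonality, the sets `T` that survive contain all primes of the
conductor. Those forced primes give the Möbius and totient factors; each other prime of `𝔞` is free
to be in `T` or not. -/
theorem exceptionalSum_eq {𝔞 : Ideal R} (h𝔞 : 𝔞 ≠ ⊥) [Fintype (R ⧸ 𝔞)] (χ : DirichletChar 𝔞)
    [DecidableEq (Ideal R)] :
    exceptionalSum χ = moebius (conductor χ) * (phi 𝔞 / phi (conductor χ)) *
      ∏ 𝔭 ∈ primeFactors 𝔞 \ primeFactors (conductor χ), (1 - (phi 𝔭 : ℂ)⁻¹) := by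
  classical
  have hT' : ∀ T ∈ (primeFactors 𝔞).powerset, ∀ 𝔭 ∈ T, Prime 𝔭 ∧ 𝔭 ∣ 𝔞 := fun T hT 𝔭 h =>
    (mem_primeFactors_iff h𝔞).1 (Finset.mem_powerset.1 hT h)
  have hJ : exceptionalSum χ = ∑ T ∈ (primeFactors 𝔞).powerset, (-1) ^ #T *
      if conductor χ ∣ ∏ 𝔭 ∈ T, 𝔭 then (phi 𝔞 : ℂ) / ∏ 𝔭 ∈ T, (phi 𝔭 : ℂ) else 0 := by
    have h1 : ∀ x : R ⧸ 𝔞, (if IsUnit (1 - x) then χ x else 0)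
        = ∑ T ∈ (primeFactors 𝔞).powerset, (-1) ^ #T *
          if x - 1 ∈ (∏ 𝔭 ∈ T, 𝔭).map (Ideal.Quotient.mk 𝔞) then χ x else 0 := fun x => by
      rw [← mul_boole, ite_isUnit_eq_sum h𝔞, Finset.mul_sum]
      refine Finset.sum_congr rfl fun T _ => ?_
      rw [← neg_mem_iff, neg_sub, mul_left_comm, mul_boole]
    rw [exceptionalSum, Finset.sum_congr rfl fun x _ => h1 x, Finset.sum_comm]
    refine Finset.sum_congr rfl fun T hT => ?_
    have hp : ∀ 𝔭 ∈ T, Prime 𝔭 := fun 𝔭 h => (hT' T hT 𝔭 h).1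
    have hd := (prod_dvd_iff hp).2 fun 𝔭 h => (hT' T hT 𝔭 h).2
    rw [← Finset.mul_sum, sum_ite_sub_one_mem h𝔞 χ hd
      (natCast_phi_ne_zero (ne_zero_of_dvd_ne_zero h𝔞 hd)), natCast_phi_prod hp]
  rw [hJ]
  have hd0 : conductor χ ≠ ⊥ := ne_zero_of_dvd_ne_zero h𝔞 (conductor_dvd h𝔞 χ)
  set 𝔡 := conductor χ
  by_cases hsq : Squarefree 𝔡
  · have hD : ∀ 𝔭 ∈ primeFactors 𝔡, Prime 𝔭 := fun 𝔭 h => ((mem_primeFactors_iff hd0).1 h).1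
    have hDP : primeFactors 𝔡 ⊆ primeFactors 𝔞 := fun 𝔭 h => by
      rw [mem_primeFactors_iff hd0] at h
      exact (mem_primeFactors_iff h𝔞).2 ⟨h.1, h.2.trans (conductor_dvd h𝔞 χ)⟩
    have hprod := prod_primeFactors_of_squarefree hsq
    have hmu := moebius_prod hD
    have hphi := natCast_phi_prod hD
    rw [hprod] at hmu hphi
    have hdvd : ∀ T ∈ (primeFactors 𝔞).powerset,
        (𝔡 ∣ ∏ 𝔭 ∈ T, 𝔭) ↔ ∀ 𝔭 ∈ primeFactors 𝔞 \ T, 𝔭 ∉ primeFactors 𝔡 := fun T hT => by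
      have hp : ∀ 𝔭 ∈ T, Prime 𝔭 := fun 𝔭 h => (hT' T hT 𝔭 h).1
      have h𝔡 := prod_dvd_iff (𝔠 := ∏ 𝔭 ∈ T, 𝔭) hD
      rw [hprod] at h𝔡
      rw [h𝔡]
      constructor
      · intro h 𝔭 h𝔭 hd
        rw [Finset.mem_sdiff] at h𝔭
        refine h𝔭.2 ?_
        rw [← primeFactors_prod hp, mem_primeFactors_iff (squarefree_prod hp).ne_zero]
        exact ⟨hD 𝔭 hd, h 𝔭 hd⟩
      · intro h 𝔭 hd
        refine Finset.dvd_prod_of_mem (fun 𝔭 => 𝔭) ?_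
        by_contra hn
        exact h 𝔭 (Finset.mem_sdiff.2 ⟨hDP hd, hn⟩) hd
    -- In this expansion `T` collects the factors `-φ(𝔭)⁻¹`; the indicator kills the term unless the
    -- complement of `T` avoids the primes of `𝔡`, that is, unless `𝔡 ∣ ∏ 𝔭 ∈ T, 𝔭`.
    have hexp := Finset.prod_add (fun 𝔭 : Ideal R => -(phi 𝔭 : ℂ)⁻¹)
      (fun 𝔭 => if 𝔭 ∉ primeFactors 𝔡 then 1 else 0) (primeFactors 𝔞)
    have hsplit : ∏ 𝔭 ∈ primeFactors 𝔞,
        (-(phi 𝔭 : ℂ)⁻¹ + if 𝔭 ∉ primeFactors 𝔡 then 1 else 0)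
        = (∏ 𝔭 ∈ primeFactors 𝔞 \ primeFactors 𝔡, (1 - (phi 𝔭 : ℂ)⁻¹)) *
          ((-1) ^ #(primeFactors 𝔡) * (phi 𝔡 : ℂ)⁻¹) := by
      rw [← Finset.prod_sdiff hDP, hphi, ← Finset.prod_inv_distrib, ← Finset.prod_neg]
      congr 1
      · refine Finset.prod_congr rfl fun 𝔭 h => ?_
        rw [if_pos (Finset.mem_sdiff.1 h).2]
        ring
      · refine Finset.prod_congr rfl fun 𝔭 h => ?_
        rw [if_neg (not_not.2 h), add_zero]
    have hmu' : ((moebius 𝔡 : ℤ) : ℂ) = (-1) ^ #(primeFactors 𝔡) := by rw [hmu]; push_cast; rfl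
    rw [hmu', div_eq_mul_inv, show ∀ a b c d : ℂ, a * (b * c) * d = b * (d * (a * c)) from
      fun _ _ _ _ => by ring, ← hsplit, hexp, Finset.mul_sum]
    refine Finset.sum_congr rfl fun T hT => ?_
    rw [Finset.prod_ite_zero, Finset.prod_neg, Finset.prod_inv_distrib, Finset.prod_const_one]
    simp only [hdvd T hT]
    split_ifs <;> ring
  -- A non-squarefree `𝔡` divides no product of distinct primes, so every term is zero.
  · rw [moebius_of_not_squarefree hsq, Int.cast_zero, zero_mul, zero_mul]
    refine Finset.sum_eq_zero fun T hT => ?_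
    rw [if_neg, mul_zero]
    exact fun h => hsq ((squarefree_prod fun 𝔭 h => (hT' T hT 𝔭 h).1).squarefree_of_dvd h)

theorem phi_one : phi (1 : Ideal R) = 1 := by
  have h : (phi (1 : Ideal R) : ℂ) = 1 := by
    rw [natCast_phi_eq one_ne_zero, primeFactors_one, map_one]
    simp
  exact_mod_cast h

theorem natCast_phi₂_eq_prod {𝔟 : Ideal R} (h𝔟 : 𝔟 ≠ ⊥) :
    (phi₂ 𝔟 : ℂ) = (phi 𝔟 : ℂ) ^ 2 * ∏ 𝔭 ∈ primeFactors 𝔟, (1 - (phi 𝔭 : ℂ)⁻¹) := by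
  classical
  have := Ideal.finiteQuotientOfFreeOfNeBot 𝔟 h𝔟
  have := Fintype.ofFinite (R ⧸ 𝔟)
  rw [natCast_phi₂_eq, exceptionalSum_eq h𝔟, conductor_one h𝔟, phi_one, primeFactors_one,
    Finset.sdiff_empty, moebius_one]
  push_cast
  ring

/-- The ratio `φ/N` depends only on the set of prime factors, which `𝔞₀`, `𝔡` and `𝔞₀ ^ 2 / 𝔡`
share, and `N` is multiplicative. -/
theorem natCast_phi_sq_div {𝔞₀ 𝔡 : Ideal R} (h0 : 𝔞₀ ≠ ⊥) (hd : 𝔡 ∣ 𝔞₀)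
    (hP : primeFactors 𝔡 = primeFactors 𝔞₀) :
    (phi (𝔞₀ ^ 2 / 𝔡) : ℂ) = (phi 𝔞₀ : ℂ) ^ 2 / phi 𝔡 := by
  classical
  have hd0 : 𝔡 ≠ ⊥ := ne_zero_of_dvd_ne_zero h0 hd
  have hdvd : 𝔡 ∣ 𝔞₀ ^ 2 := hd.trans (dvd_pow_self _ two_ne_zero)
  have hq0 : 𝔞₀ ^ 2 / 𝔡 ≠ ⊥ := div_ne_bot (pow_ne_zero 2 h0) hdvd
  have hmul := div_mul_cancel_of_dvd hdvd
  have hdq : 𝔞₀ ∣ 𝔞₀ ^ 2 / 𝔡 := by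
    rw [dvd_div_iff_mul_dvd (pow_ne_zero 2 h0) hdvd, sq]
    exact mul_dvd_mul_left _ hd
  have hPq : primeFactors (𝔞₀ ^ 2 / 𝔡) = primeFactors 𝔞₀ := by
    refine Finset.Subset.antisymm ?_ ?_
    · rw [← primeFactors_pow 𝔞₀ two_ne_zero, ← hmul, primeFactors_mul_eq_union hq0 hd0, hmul]
      exact Finset.subset_union_left
    · intro 𝔭
      rw [mem_primeFactors_iff h0, mem_primeFactors_iff hq0]
      exact fun h => ⟨h.1, h.2.trans hdq⟩
  have hN : (Ideal.absNorm (𝔞₀ ^ 2 / 𝔡) : ℂ) * Ideal.absNorm 𝔡 = (Ideal.absNorm 𝔞₀ : ℂ) ^ 2 := by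
    exact_mod_cast by rw [← map_mul, hmul, map_pow]
  rw [eq_div_iff (natCast_phi_ne_zero hd0), natCast_phi_eq hq0, natCast_phi_eq hd0,
    natCast_phi_eq h0, hPq, hP]
  linear_combination (∏ 𝔭 ∈ primeFactors 𝔞₀, (1 - (Ideal.absNorm 𝔭 : ℂ)⁻¹)) ^ 2 * hN

/-- The character sum over exceptional units in terms of `μ`, `φ` and `φ₂`. -/
theorem exceptionalSum_mul_phi {𝔞 𝔞₀ : Ideal R} (h𝔞 : 𝔞 ≠ ⊥) [Fintype (R ⧸ 𝔞)]
    (χ : DirichletChar 𝔞) (h𝔞₀ : 𝔞₀ ∣ 𝔞)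
    (hprimes : ∀ 𝔭 : Ideal R, Prime 𝔭 → (𝔭 ∣ 𝔞₀ ↔ 𝔭 ∣ conductor χ))
    (hcoprime : IsCoprime 𝔞₀ (𝔞 / 𝔞₀)) :
    exceptionalSum χ * phi 𝔞
      = moebius (conductor χ) * phi (𝔞₀ ^ 2 / conductor χ) * phi₂ (𝔞 / 𝔞₀) := by
  classical
  have h0 : 𝔞₀ ≠ ⊥ := ne_zero_of_dvd_ne_zero h𝔞 h𝔞₀
  have hb0 : 𝔞 / 𝔞₀ ≠ ⊥ := div_ne_bot h𝔞 h𝔞₀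
  have hmul : 𝔞₀ * (𝔞 / 𝔞₀) = 𝔞 := by rw [mul_comm, div_mul_cancel_of_dvd h𝔞₀]
  have hd0 : conductor χ ≠ ⊥ := ne_zero_of_dvd_ne_zero h𝔞 (conductor_dvd h𝔞 χ)
  have hP : primeFactors (conductor χ) = primeFactors 𝔞₀ := by
    ext 𝔭
    rw [mem_primeFactors_iff h0, mem_primeFactors_iff hd0]
    exact and_congr_right fun h => (hprimes 𝔭 h).symm
  -- A common prime would divide `𝔞₀` as well, against `hcoprime`. Hence the conductor divides `𝔞₀`.
  have hrel : IsRelPrime (conductor χ) (𝔞 / 𝔞₀) := by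
    refine WfDvdMonoid.isRelPrime_of_no_irreducible_factors (fun h => hd0 h.1) fun 𝔭 h𝔭 hd hb => ?_
    have h1 := (hprimes 𝔭 h𝔭.prime).2 hd
    exact h𝔭.not_isUnit (hcoprime.isRelPrime h1 hb)
  have hd : conductor χ ∣ 𝔞₀ := hrel.dvd_of_dvd_mul_right (hmul.symm ▸ conductor_dvd h𝔞 χ)
  have hsd : primeFactors 𝔞 \ primeFactors (conductor χ) = primeFactors (𝔞 / 𝔞₀) := by
    conv_lhs => rw [hP, ← hmul, primeFactors_mul_eq_union h0 hb0, Finset.union_sdiff_left]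
    exact Finset.sdiff_eq_self_of_disjoint (disjoint_primeFactors hcoprime.isRelPrime).symm
  have hphi : (phi 𝔞 : ℂ) = phi 𝔞₀ * phi (𝔞 / 𝔞₀) := by
    rw [← natCast_phi_mul h0 hb0 hcoprime, hmul]
  rw [exceptionalSum_eq h𝔞, hsd, natCast_phi_sq_div h0 hd hP, natCast_phi₂_eq_prod hb0, hphi]
  ring

/-! ### The sum of gcd norms. -/

theorem natCast_absNorm_div {𝔞 𝔠 : Ideal R} (h𝔞 : 𝔞 ≠ ⊥) (h : 𝔠 ∣ 𝔞) :
    (Ideal.absNorm (𝔞 / 𝔠) : ℂ) = Ideal.absNorm 𝔞 / Ideal.absNorm 𝔠 := by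
  rw [eq_div_iff (Nat.cast_ne_zero.2 (absNorm_ne_zero (ne_zero_of_dvd_ne_zero h𝔞 h)))]
  exact_mod_cast by rw [← map_mul, div_mul_cancel_of_dvd h]

open Classical in
-- Gauss's identity writes the norm as a sum over divisors `𝔠` of the gcd. For fixed `𝔠`, each of
-- the `s` coordinates of `b` independently has `N(𝔞/𝔠)` admissible values.
theorem sum_absNorm_gcdMod_cons {𝔞 : Ideal R} (h𝔞 : 𝔞 ≠ ⊥) [Fintype (R ⧸ 𝔞)] (s : ℕ) (x : R ⧸ 𝔞) :
    ∑ b : Fin s → R ⧸ 𝔞,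
      (Ideal.absNorm (gcdMod 𝔞 (Fin.cons x b : Fin (s + 1) → R ⧸ 𝔞)) : ℂ)
      = ∑ 𝔠 ∈ (finite_divisors h𝔞).toFinset, phi 𝔠 * (Ideal.absNorm (𝔞 / 𝔠) : ℂ) ^ s *
        if x ∈ 𝔠.map (Ideal.Quotient.mk 𝔞) then 1 else 0 := by
  have h1 : ∀ b : Fin s → R ⧸ 𝔞,
      (Ideal.absNorm (gcdMod 𝔞 (Fin.cons x b : Fin (s + 1) → R ⧸ 𝔞)) : ℂ)
      = ∑ 𝔠 ∈ (finite_divisors h𝔞).toFinset, phi 𝔠 *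
        (if x ∈ 𝔠.map (Ideal.Quotient.mk 𝔞) then 1 else 0) *
        ∏ i, if b i ∈ 𝔠.map (Ideal.Quotient.mk 𝔞) then (1 : ℂ) else 0 := fun b => by
    have hle := le_gcdMod (Fin.cons x b : Fin (s + 1) → R ⧸ 𝔞)
    have hne : gcdMod 𝔞 (Fin.cons x b : Fin (s + 1) → R ⧸ 𝔞) ≠ ⊥ := fun h =>
      h𝔞 (le_bot_iff.1 (h ▸ hle))
    have hsub : (finite_divisors hne).toFinset = (finite_divisors h𝔞).toFinset.filter fun 𝔠 =>
        x ∈ 𝔠.map (Ideal.Quotient.mk 𝔞) ∧ ∀ i, b i ∈ 𝔠.map (Ideal.Quotient.mk 𝔞) := by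
      ext 𝔠
      simp only [Finset.mem_filter, Set.Finite.mem_toFinset, Set.mem_ofPred_eq, Ideal.dvd_iff_le]
      constructor
      · intro h
        have h2 := hle.trans h
        rw [gcdMod_le_iff h2, Fin.forall_fin_succ] at h
        simpa using ⟨h2, h⟩
      · rintro ⟨h, h2⟩
        rw [gcdMod_le_iff h, Fin.forall_fin_succ]
        simpa using h2
    rw [← sum_phi_eq_absNorm hne, hsub, Finset.sum_filter, Nat.cast_sum]
    refine Finset.sum_congr rfl fun 𝔠 _ => ?_
    rw [Finset.prod_ite_zero, Finset.prod_const_one]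
    by_cases h3 : x ∈ 𝔠.map (Ideal.Quotient.mk 𝔞) <;>
      by_cases h4 : ∀ i, b i ∈ 𝔠.map (Ideal.Quotient.mk 𝔞) <;> simp [h3, h4]
  rw [Finset.sum_congr rfl fun b _ => h1 b, Finset.sum_comm]
  refine Finset.sum_congr rfl fun 𝔠 hc => ?_
  have hc' : 𝔠 ∣ 𝔞 := by simpa using hc
  rw [← Finset.mul_sum, ← Fintype.sum_pow
    (fun y => if y ∈ 𝔠.map (Ideal.Quotient.mk 𝔞) then (1 : ℂ) else 0), sum_ite_mem_map h𝔞 hc', natCast_absNorm_div h𝔞 hc']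
  ring

theorem sum_mul_sum_absNorm_gcdMod {𝔞 : Ideal R} (h𝔞 : 𝔞 ≠ ⊥) [Fintype (R ⧸ 𝔞)]
    (χ : DirichletChar 𝔞) (s : ℕ) :
    ∑ u : R ⧸ 𝔞, (∑ b : Fin s → R ⧸ 𝔞,
      (Ideal.absNorm (gcdMod 𝔞 (Fin.cons (u - 1) b : Fin (s + 1) → R ⧸ 𝔞)) : ℂ)) * χ u
      = phi 𝔞 * sigma s (𝔞 / conductor χ) := by
  classical
  simp only [sum_absNorm_gcdMod_cons h𝔞, Finset.sum_mul]
  rw [Finset.sum_comm, natCast_sigma_div h𝔞 (conductor_dvd h𝔞 χ), Finset.mul_sum]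
  refine Finset.sum_congr rfl fun 𝔠 hc => ?_
  have hc' : 𝔠 ∣ 𝔞 := by simpa using hc
  have hphi := natCast_phi_ne_zero (ne_zero_of_dvd_ne_zero h𝔞 hc')
  simp only [mul_assoc, ite_mul, one_mul, zero_mul, ← Finset.mul_sum]
  -- Orthogonality supplies `φ(𝔞)/φ(𝔠)`, whose denominator cancels the weight `φ(𝔠)`.
  rw [sum_ite_sub_one_mem h𝔞 χ hc' hphi]
  split_ifs
  · field_simp
  · simp

end Dedekind

end MenonSury

open Classical in
theorem theorem1p2 {K : Type*} [Field K] [NumberField K] (𝔞 : Ideal (𝓞 K)) [NeZero 𝔞]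
    (χ : MenonSury.DirichletChar 𝔞) (s : ℕ) (𝔞₀ : Ideal (𝓞 K)) (h𝔞₀ : 𝔞₀ ∣ 𝔞)
    (hprimes : ∀ 𝔭 : Ideal (𝓞 K), Prime 𝔭 → (𝔭 ∣ 𝔞₀ ↔ 𝔭 ∣ MenonSury.conductor χ))
    (hcoprime : IsCoprime 𝔞₀ (𝔞 / 𝔞₀)) :
    ∑ a₁ : 𝓞 K ⧸ 𝔞, ∑ a₂ : 𝓞 K ⧸ 𝔞, ∑ b : Fin s → 𝓞 K ⧸ 𝔞,
      (if IsUnit (a₁ * a₂) ∧ IsUnit (a₁ + a₂) then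
        (Ideal.absNorm (MenonSury.gcdMod 𝔞 (Fin.cons (a₁ + a₂ - 1) b : Fin (s + 1) → 𝓞 K ⧸ 𝔞)) : ℂ)
          * χ a₁
      else 0) =
    (UniqueFactorizationMonoid.moebius (MenonSury.conductor χ) : ℂ)
      * (MenonSury.phi (𝔞₀ ^ 2 / MenonSury.conductor χ) : ℂ)
      * (MenonSury.phi₂ (𝔞 / 𝔞₀) : ℂ)
      * (MenonSury.sigma s (𝔞 / MenonSury.conductor χ) : ℂ) := by
  have h𝔞 : 𝔞 ≠ ⊥ := NeZero.ne 𝔞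
  -- The factor `φ(𝔞)` from the gcd sum is what completes `exceptionalSum χ` to the expression in
  -- `𝔞₀`.
  rw [← MenonSury.exceptionalSum_mul_phi h𝔞 χ h𝔞₀ hprimes hcoprime, mul_assoc,
    ← MenonSury.sum_mul_sum_absNorm_gcdMod h𝔞 χ s, ← MenonSury.sum_pairs_eq]
  refine Finset.sum_congr rfl fun a₁ _ => Finset.sum_congr rfl fun a₂ _ => ?_
  split_ifs
  · rw [Finset.sum_mul]
  · exact Finset.sum_const_zero
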